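/- **Theorem (Security of the $w_a$-parametrized FlyClient verifier).** *Setting.* The hash function is a random oracle with $\kappa(\lambda)$-bit values, where $2^{-\kappa(\lambda)}$ is negligible in the security parameter $\lambda$. A proof-of-work blockchain is given by a genesis header, a rule that decides from a fixed number of preceding headers whether the difficulty of a header is correct, and a check of puzzle solutions. Each header other than the genesis contains the hash of the previous header, the hash of the root of the Merkle Mountain Range (MMR) over all previous headers, a timestamp and a difficulty $d$; its proof of work is valid if $d>0$, its hash is below $2^{\kappa}/d$ and its puzzle solution is valid. MMR nodes also contain the heights, timestamps and difficulties of the first and last covered block and the cumulative work of the covered blocks. A chain is valid if it starts at the genesis and all its later headers have correct previous hashes, MMR roots, proofs of work and difficulties. *Verifier.* Let $0<c<1$ and $0<L<n$ (all of $n,c,L,w_a$ may depend on $\lambda$). The FlyClient verifier for chains of length $n$ receives a tip header and checks the tip and the $n_{\mathrm{det}}$ headers preceding it (links to the tip, proof of work, difficulty transitions, and MMR ancestry proofs with respect to the tip), and then checks proof of work and MMR ancestry proof of the blocks at $n_{\mathrm{prob}}$ points of the cumulative work, drawn with density proportional to $1/(1-x)$ in the relative work $x\in[0,1-\delta]$.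 Here $d_i$ is the difficulty of the $i$-th block of the presented chain, $\delta=\sum_{i=n-L+1}^n d_i\big/\sum_{i=1}^n d_i$ (the total work being the one committed to by the tip), $n_{\mathrm{det}}=L$, and, rounded up, $$n_{\mathrm{prob}}=\frac{\lambda}{\log_{0.5}\bigl(1-\frac1{\log_c\delta}\bigr)}\ \text{(interactive)},\qquad n_{\mathrm{prob}}=\frac{\lambda-\log_{0.5}(c\,n)}{\log_{0.5}\bigl(1-\frac1{\log_c\delta}\bigr)}\ \text{(non-interactive)}$$ if $0<\delta<c$, and $n_{\mathrm{prob}}=0$ if $\delta\ge c$, where these formulas have no value. The interactive verifier draws the points itself; in the non-interactive version they are derived from hashes of the tip (Fiat–Shamir) and the proof is produced at once. *Adversary.* Consider executions of a (computationally unbounded, probabilistic) attacker against such a verifier, in the presence of honest miners, who only generate blocks that extend a valid chain, with polynomially many (in $\lambda$) hash evaluations in total. A generated block that is neither honest nor the genesis is malicious; a single block, possibly on top of invalid ones, is called valid if its proof of work is valid and its difficulty is correct with respect to the headers preceding it. The attacker is a *$w_a$-adversary* if the valid malicious blocks generated in the execution have cumulative work at most $w_a$, except with probability negligible in $\lambda$.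 *Claim.* For the interactive as well as for the non-interactive verifier, if the attacker is a $w_a$-adversary, then the probability that the verifier accepts an invalid chain while $$L\ \ge\ \min\Bigl\{\nu : \sum_{i=n-\nu+1}^{n} d_i\ \ge\ w_a/c\Bigr\}$$ holds for the presented chain is negligible in $\lambda$. (The minimum of the empty set is $+\infty$. The verifier accepts an invalid chain if it accepts although the headers generated in the execution contain no valid chain of length $n$ that ends in the presented tip.) -/

import Mathlib

namespace FlyClient

noncomputable section

open Classical

/-! ## Hashes, headers, and programs with a random oracle -/

/-- Hash values of `κ` bits, read as numbers. -/
abbrev Digest (κ : ℕ) : Type := Fin (2 ^ κ)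

/-- A block header. `prevHash` is the hash of the previous header, `historyRoot` the hash of the
root of the MMR over all previous headers; both are null (`none`) in the genesis header.
`payload` encodes all the remaining content (nonce, puzzle solution, transaction commitment). -/
structure Header (κ : ℕ) where
  prevHash : Option (Digest κ)
  historyRoot : Option (Digest κ)
  time : ℕ
  difficulty : ℕ
  payload : ℕ

/-- A node of the MMR: a hash, and the heights, timestamps and difficulties of the first and of the
last covered block, with the cumulative work of all covered blocks. -/
structure MMRNode (κ : ℕ) where
  hash : Digest κ
  firstHeight : ℕ
  lastHeight : ℕ
  firstTime : ℕ
  lastTime : ℕ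
  firstDifficulty : ℕ
  lastDifficulty : ℕ
  work : ℕ

/-- The strings that get hashed: headers, pairs of MMR children, MMR roots (for the commitment
in the header), and Fiat-Shamir challenges `(tip, j)`. -/
inductive HashInput (κ : ℕ) : Type
  | header (h : Header κ)
  | children (l r : MMRNode κ)
  | root (r : MMRNode κ)
  | challenge (tip : Header κ) (j : ℕ)

/-- Probabilistic programs with access to the hash function, given as decision trees. -/
inductive Prog (κ : ℕ) (α : Type) : Type
  | pure (a : α) : Prog κ α
  | hash (x : HashInput κ) (k : Digest κ → Prog κ α) : Prog κ α
  | sample (p : PMF ℕ) (k : ℕ → Prog κ α) : Prog κ α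

namespace Prog

variable {κ : ℕ}

def bind {α β : Type} : Prog κ α → (α → Prog κ β) → Prog κ β
  | .pure a, f => f a
  | .hash x k, f => .hash x fun d => (k d).bind f
  | .sample p k, f => .sample p fun i => (k i).bind f

instance : Monad (Prog κ) where
  pure := Prog.pure
  bind := Prog.bind

/-- Evaluate the hash function once. -/
def ask (x : HashInput κ) : Prog κ (Digest κ) := .hash x .pure

/-- Draw from a distribution. -/
def draw (p : PMF ℕ) : Prog κ ℕ := .sample p .pure

end Prog

/-- The hash evaluations made so far (by anybody), latest first. -/
abbrev Table (κ : ℕ) : Type := List (HashInput κ × Digest κ)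

/-- The recorded hash of `x`, if `x` was ever hashed. -/
def Table.get {κ : ℕ} (T : Table κ) (x : HashInput κ) : Option (Digest κ) :=
  (T.find? fun e => decide (e.1 = x)).map Prod.snd

/-- Joint law of the result of a program and of the table of all hash evaluations, when the hash
function is a random oracle: a fresh input gets a uniform digest, a repeated one its old digest. -/
def Prog.run {κ : ℕ} {α : Type} : Prog κ α → Table κ → PMF (α × Table κ)
  | .pure a, T => PMF.pure (a, T)
  | .hash x k, T =>
      match T.get x with
      | some d => (k d).run T
      | none => (PMF.uniformOfFintype (Digest κ)).bind fun d => (k d).run ((x, d) :: T)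
  | .sample p k, T => p.bind fun i => (k i).run T

/-! ## Consensus rules and valid chains -/

/-- The rules of a proof-of-work blockchain: the content of the genesis header, the rule that says
whether a header has a correct difficulty (and time) given the `window` headers before it (latest
first), a check of the puzzle solution beyond the comparison of the header's hash with the target
(constantly true where there is none), and the plausibility check for the difficulty transitions
among the blocks covered by an MMR node. -/
structure Consensus (κ : ℕ) where
  genesisTime : ℕ
  genesisDifficulty : ℕ
  genesisPayload : ℕ
  window : ℕ
  difficultyRule : List (Header κ) → Header κ → Prop
  solutionValid : Header κ → Prop
  plausible : MMRNode κ → Prop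

variable {κ : ℕ}

def Consensus.genesis (R : Consensus κ) : Header κ where
  prevHash := none
  historyRoot := none
  time := R.genesisTime
  difficulty := R.genesisDifficulty
  payload := R.genesisPayload

/-- Valid proof of work of a header with hash `d`: the hash is below the target
`2 ^ κ / difficulty`. -/
def Consensus.PowValid (R : Consensus κ) (h : Header κ) (d : Digest κ) : Prop :=
  0 < h.difficulty ∧ (d : ℕ) * h.difficulty < 2 ^ κ ∧ R.solutionValid h

/-- The MMR leaf of the header `h` with hash `d` at height `i`. -/
def leafNode (i : ℕ) (h : Header κ) (d : Digest κ) : MMRNode κ where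
  hash := d
  firstHeight := i
  lastHeight := i
  firstTime := h.time
  lastTime := h.time
  firstDifficulty := h.difficulty
  lastDifficulty := h.difficulty
  work := h.difficulty

/-- The parent of `l` and `r`, where `d` is the hash of the pair. -/
def parentNode (l r : MMRNode κ) (d : Digest κ) : MMRNode κ where
  hash := d
  firstHeight := l.firstHeight
  lastHeight := r.lastHeight
  firstTime := l.firstTime
  lastTime := r.lastTime
  firstDifficulty := l.firstDifficulty
  lastDifficulty := r.lastDifficulty
  work := l.work + r.work

/-- Number of leaves under the left child of the root of an MMR with `N ≥ 2` leaves: the largest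
power of two below `N`. -/
def mmrSplit (N : ℕ) : ℕ := 2 ^ Nat.log 2 (N - 1)

theorem mmrSplit_pos (N : ℕ) : 0 < mmrSplit N := by
  unfold mmrSplit; positivity

theorem mmrSplit_lt {N : ℕ} (h : 2 ≤ N) : mmrSplit N < N := by
  have := Nat.pow_log_le_self 2 (x := N - 1) (by omega)
  unfold mmrSplit
  omega

/-- The root node of the MMR over the headers `C` (oldest first), the first one at height `s`,
computed with the recorded hashes (`none` if `C` is empty or one of the hashes is missing).
The mountains are the maximal perfect subtrees at the left. -/
def mmrRoot (T : Table κ) (s : ℕ) (C : List (Header κ)) : Option (MMRNode κ) :=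
  match C with
  | [] => none
  | [h] => (T.get (.header h)).map (leafNode s h)
  | h₁ :: h₂ :: t =>
      let k := mmrSplit (t.length + 2)
      match mmrRoot T s ((h₁ :: h₂ :: t).take k),
          mmrRoot T (s + k) ((h₁ :: h₂ :: t).drop k) with
      | some l, some r => (T.get (.children l r)).map (parentNode l r)
      | _, _ => none
termination_by C.length
decreasing_by
  · have := mmrSplit_lt (N := t.length + 2) (by omega)
    simp only [List.length_take, List.length_cons]; omega
  · have := mmrSplit_pos (t.length + 2)
    simp only [List.length_drop, List.length_cons]; omega

/-- `ValidChain R T C`: the headers `C`, latest first, all hashed in the execution with table `T`,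
form a valid chain: it starts at the genesis, every header has the hash of the previous one, the
root of the MMR over all previous ones, a valid proof of work and a correct difficulty. -/
inductive ValidChain (R : Consensus κ) (T : Table κ) : List (Header κ) → Prop
  | genesis : ValidChain R T [R.genesis]
  | extend {h p : Header κ} {C : List (Header κ)} {dh dp e : Digest κ} {r : MMRNode κ}
      (valid : ValidChain R T (p :: C))
      (hash_prev : T.get (.header p) = some dp)
      (linked : h.prevHash = some dp)
      (hash_eq : T.get (.header h) = some dh)
      (pow : R.PowValid h dh)
      (difficulty : R.difficultyRule ((p :: C).take R.window) h)
      (root_eq : mmrRoot T 0 (p :: C).reverse = some r)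
      (hash_root : T.get (.root r) = some e)
      (committed : h.historyRoot = some e) :
      ValidChain R T (h :: p :: C)

/-- A single valid block, possibly on top of invalid ones: it was hashed, has a valid proof of work,
and respects the difficulty rule with respect to the `window` headers that precede it through the
hash links (fewer if these reach the genesis). -/
def ValidBlock (R : Consensus κ) (T : Table κ) (h : Header κ) : Prop :=
  ∃ (d : Digest κ) (prev : List (Header κ)),
    T.get (.header h) = some d ∧ R.PowValid h d ∧
    List.IsChain (fun x y => ∃ e, T.get (.header y) = some e ∧ x.prevHash = some e) (h :: prev) ∧
    (prev.length = R.window ∨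
      (prev.length < R.window ∧ prev.getLast? = some R.genesis)) ∧
    R.difficultyRule prev h

/-! ## The FlyClient verifier -/

/-- The first message of a prover for a chain of length `n`, with heights `0, …, n - 1`: the root
node of the MMR of the tip header, the last headers of the chain (tip first), and the
ancestry proofs of those deterministically sampled. -/
structure Commitment (κ : ℕ) where
  root : MMRNode κ
  headers : List (Header κ)
  ancestry : List (List (MMRNode κ))

/-- The answer to a probabilistic sample: a header, its height, and its ancestry proof. -/
structure Opening (κ : ℕ) where
  height : ℕ
  header : Header κ
  ancestry : List (MMRNode κ)

/-- The node claims to cover `len` blocks from height `s` on. -/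
def MMRNode.Covers (q : MMRNode κ) (s len : ℕ) : Prop :=
  q.firstHeight = s ∧ q.lastHeight + 1 = s + len

/-- Recompute the root of an MMR with `N` leaves, the first one at height `s`, from its leaf number
`i` and the siblings on the path from the root down to that leaf. Also returns the left siblings,
from top to bottom: these are the peaks of the MMR over the first `i` leaves. -/
def openPath (R : Consensus κ) (leaf : MMRNode κ) :
    List (MMRNode κ) → (s N i : ℕ) → Prog κ (Option (MMRNode κ × List (MMRNode κ)))
  | [], _, N, _ => pure (if N = 1 then some (leaf, []) else none)
  | q :: qs, s, N, i =>
      if N ≤ 1 ∨ ¬ R.plausible q then pure none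
      else if i < mmrSplit N then
        if q.Covers (s + mmrSplit N) (N - mmrSplit N) then do
          match ← openPath R leaf qs s (mmrSplit N) i with
          | none => pure none
          | some (l, lefts) =>
              let d ← Prog.ask (.children l q)
              pure (some (parentNode l q d, lefts))
        else pure none
      else
        if q.Covers s (mmrSplit N) then do
          match ← openPath R leaf qs (s + mmrSplit N) (N - mmrSplit N) (i - mmrSplit N) with
          | none => pure none
          | some (r, lefts) =>
              let d ← Prog.ask (.children q r)
              pure (some (parentNode q r d, q :: lefts))
        else pure none

/-- Reduce the peaks of an MMR to its root. -/
def bagPeaks : List (MMRNode κ) → Prog κ (Option (MMRNode κ))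
  | [] => pure none
  | [p] => pure (some p)
  | p :: q :: ps => do
      match ← bagPeaks (q :: ps) with
      | none => pure none
      | some r =>
          let d ← Prog.ask (.children p r)
          pure (some (parentNode p r d))

/-- Check the ancestry proof `sib` of the header `h` (with hash `d`) at height `i`, with respect to
the MMR with root node `root` over `N` headers: the root is recomputed from the proof, and the MMR
root in `h` is that of the MMR over the first `i` headers. At height `0` only the genesis
is accepted. Returns the work claimed before `h`, or `none` for a rejection. -/
def checkAncestry (R : Consensus κ) (root : MMRNode κ) (N i : ℕ) (h : Header κ) (d : Digest κ)
    (sib : List (MMRNode κ)) : Prog κ (Option ℕ) := do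
  if i < N then
    match ← openPath R (leafNode i h d) sib 0 N i with
    | none => pure none
    | some (r, lefts) =>
        if r ≠ root then pure none
        else if i = 0 then pure (if h = R.genesis then some 0 else none)
        else
          match ← bagPeaks lefts with
          | none => pure none
          | some p =>
              let e ← Prog.ask (.root p)
              pure (if h.historyRoot = some e then some (lefts.map MMRNode.work).sum else none)
  else pure none

/-- Hash all headers of a list. -/
def hashHeaders : List (Header κ) → Prog κ (List (Header κ × Digest κ))
  | [] => pure []
  | h :: t => do
      let d ← Prog.ask (.header h)
      let ds ← hashHeaders t
      pure ((h, d) :: ds)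

/-- Check the blocks in a list of headers (latest first, the latest one at height `i`): the first
`m` of them have a valid proof of work and a correct difficulty, except that the one at height `0`
has to be the genesis. -/
def BlocksOk (R : Consensus κ) : (m i : ℕ) → List (Header κ × Digest κ) → Prop
  | _, _, [] => True
  | _, 0, x :: t => x.1 = R.genesis ∧ t = []
  | m, i + 1, x :: t =>
      (0 < m → R.PowValid x.1 x.2 ∧
        R.difficultyRule ((t.map Prod.fst).take R.window) x.1) ∧
      BlocksOk R (m - 1) i t

/-- Check the ancestry proofs of a list of headers at heights `i, i - 1, …`. -/
def checkAncestries (R : Consensus κ) (root : MMRNode κ) (N : ℕ) :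
    ℕ → List (Header κ × Digest κ) → List (List (MMRNode κ)) → Prog κ Bool
  | _, [], [] => pure true
  | i, x :: xs, sib :: sibs => do
      let a ← checkAncestry R root N i x.1 x.2 sib
      let b ← checkAncestries R root N (i - 1) xs sibs
      pure (a.isSome && b)
  | _, _, _ => pure false

/-- The deterministic phase for a chain of length `n` with `nDet` samples. The verifier downloads
the tip, the `nDet` headers before it and the `window` headers before these (as far as they exist);
checks that they are chained to the tip; checks the proof of work and the difficulty transition of
the tip and of the `nDet` samples; and checks the MMR root in the tip and the ancestry proofs of the
samples with respect to the tip. -/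
def checkDet (R : Consensus κ) (n nDet : ℕ) (com : Commitment κ) : Prog κ Bool := do
  let hs ← hashHeaders com.headers
  let e ← Prog.ask (.root com.root)
  let b ← checkAncestries R com.root (n - 1) (n - 2) ((hs.drop 1).take nDet) com.ancestry
  pure (b && decide (
    com.headers.length = min n (nDet + 1 + R.window) ∧
    com.headers.head?.bind Header.historyRoot = some e ∧
    List.IsChain (fun x y : Header κ × Digest κ => x.1.prevHash = some y.2) hs ∧
    BlocksOk R (nDet + 1) (n - 1) hs))

/-- Check one probabilistic sample, the block that holds the work unit `u`: proof of work, ancestry,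
and the position of `u`. -/
def checkOpening (R : Consensus κ) (n : ℕ) (com : Commitment κ) (u : ℕ) (o : Opening κ) :
    Prog κ Bool := do
  let d ← Prog.ask (.header o.header)
  match ← checkAncestry R com.root (n - 1) o.height o.header d o.ancestry with
  | none => pure false
  | some w => pure (decide (
      (o.header = R.genesis ∨ R.PowValid o.header d) ∧ w ≤ u ∧ u < w + o.header.difficulty))

/-- Check the answers to all probabilistic samples. -/
def checkOpenings (R : Consensus κ) (n : ℕ) (com : Commitment κ) :
    List ℕ → List (Opening κ) → Prog κ Bool
  | [], [] => pure true
  | u :: us, o :: os => do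
      let a ← checkOpening R n com u o
      let b ← checkOpenings R n com us os
      pure (a && b)
  | _, _ => pure false

/-! ### Parameters and sampling distribution -/

/-- Difficulties of the downloaded headers, tip first. -/
def Commitment.difficulties (com : Commitment κ) : List ℕ := com.headers.map Header.difficulty

/-- The work of the last `L` blocks. -/
def Commitment.suffixWork (com : Commitment κ) (L : ℕ) : ℕ := (com.difficulties.take L).sum

/-- The total work of the chain: that of the blocks before the tip, and that of the tip. -/
def Commitment.totalWork (com : Commitment κ) : ℕ :=
  com.root.work + (com.difficulties.take 1).sum

/-- The fraction `δ` of the total work in the last `L` blocks. -/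
def Commitment.delta (com : Commitment κ) (L : ℕ) : ℝ := com.suffixWork L / com.totalWork

/-- Number of probabilistic samples of the interactive verifier,
`lam / log_{0.5} (1 - 1 / log_c δ)`, rounded up. The formula has a value for `0 < δ < c < 1`;
elsewhere the verifier makes no probabilistic samples. -/
def nProbInteractive (lam : ℕ) (c δ : ℝ) : ℕ :=
  if 0 < δ ∧ δ < c then
    ⌈(lam : ℝ) / Real.logb (1 / 2) (1 - 1 / Real.logb c δ)⌉₊
  else 0

/-- Number of probabilistic samples of the non-interactive verifier,
`(lam - log_{0.5} (c n)) / log_{0.5} (1 - 1 / log_c δ)`, rounded up. -/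
def nProbNonInteractive (lam : ℕ) (n : ℕ) (c δ : ℝ) : ℕ :=
  if 0 < δ ∧ δ < c then
    ⌈((lam : ℝ) - Real.logb (1 / 2) (c * n)) / Real.logb (1 / 2) (1 - 1 / Real.logb c δ)⌉₊
  else 0

/-- Weight of the work unit `u`, that is of the interval `[u / W, (u + 1) / W]`, under the density
`1 / (1 - x)` on `[0, 1 - δ]` (up to normalization), where `δ = S / W`. -/
def unitWeight (W S u : ℕ) : ENNReal :=
  if u + S < W then ENNReal.ofReal (Real.log (((W : ℝ) - u) / ((W : ℝ) - u - 1))) else 0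

/-- The FlyClient sampling distribution on the units of work before the last `S` units, out of `W`:
density proportional to `1 / (1 - x)` in the relative work `x ∈ [0, 1 - S / W]`. -/
def sampleWork (W S : ℕ) : PMF ℕ :=
  if h : ∑' u, unitWeight W S u ≠ 0 ∧ ∑' u, unitWeight W S u ≠ ⊤ then
    PMF.normalize (unitWeight W S) h.1 h.2
  else PMF.pure 0

/-- `m` independent samples. -/
def drawSamples (p : PMF ℕ) : ℕ → Prog κ (List ℕ)
  | 0 => pure []
  | m + 1 => do
      let u ← Prog.draw p
      let us ← drawSamples p m
      pure (u :: us)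

/-- `m` samples by the Fiat-Shamir heuristic, starting from number `j`: the hash of `(tip, j)`, read
as a number `v ∈ [0, 1)`, is mapped through the quantile function `1 - δ ^ v` of the sampling
distribution. -/
def hashSamples (tip : Header κ) (W : ℕ) (δ : ℝ) : (j m : ℕ) → Prog κ (List ℕ)
  | _, 0 => pure []
  | j, m + 1 => do
      let d ← Prog.ask (.challenge tip j)
      let us ← hashSamples tip W δ (j + 1) m
      pure (⌊(1 - δ ^ (((d : ℕ) : ℝ) / 2 ^ κ)) * W⌋₊ :: us)

/-! ## Attack executions -/

/-- An attacker in an execution with an interactive verifier, together with the honest network it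
runs along with (in any interleaving): it produces a first message, then is given the sampled work
units, and answers them. The last component is the list of the blocks mined by honest miners. -/
abbrev InteractiveAttacker (κ : ℕ) : Type :=
  Prog κ (Commitment κ × (List ℕ → Prog κ (List (Opening κ) × List (Header κ))))

/-- An attacker against a non-interactive verifier: it produces a whole proof at once. The last
component is the list of the blocks mined by honest miners. -/
abbrev NonInteractiveAttacker (κ : ℕ) : Type :=
  Prog κ (Commitment κ × List (Opening κ) × List (Header κ))

/-- The result of an attack execution. -/
structure Outcome (κ : ℕ) where
  com : Commitment κ
  honest : List (Header κ)
  accepted : Bool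

/-- Execution with the interactive verifier with security parameter `lam` and parameters `(c, L)`,
for chains of length `n`. -/
def interactiveGame (R : Consensus κ) (lam n : ℕ) (c : ℝ) (L : ℕ) (A : InteractiveAttacker κ) :
    Prog κ (Outcome κ) := do
  let (com, answer) ← A
  let ok ← checkDet R n L com
  let us ← drawSamples (sampleWork com.totalWork (com.suffixWork L))
    (if ok then nProbInteractive lam c (com.delta L) else 0)
  let (os, honest) ← answer us
  let ok' ← checkOpenings R n com us os
  pure ⟨com, honest, ok && ok'⟩

/-- Execution with the non-interactive verifier. -/
def nonInteractiveGame (R : Consensus κ) (lam n : ℕ) (c : ℝ) (L : ℕ)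
    (A : NonInteractiveAttacker κ) : Prog κ (Outcome κ) := do
  let (com, os, honest) ← A
  let ok ← checkDet R n L com
  match com.headers with
  | [] => pure ⟨com, honest, false⟩
  | tip :: _ =>
      let us ← hashSamples tip com.totalWork (com.delta L) 0
        (if ok then nProbNonInteractive lam n c (com.delta L) else 0)
      let ok' ← checkOpenings R n com us os
      pure ⟨com, honest, ok && ok'⟩

/-- The law of an execution: its outcome and all the hash evaluations made in it. -/
def law (G : Prog κ (Outcome κ)) : PMF (Outcome κ × Table κ) := G.run []

/-- Probability of an event in an execution. -/
def prob (G : Prog κ (Outcome κ)) (E : Outcome κ → Table κ → Prop) : ℝ :=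
  ((law G).toOuterMeasure {x | E x.1 x.2}).toReal

/-- All headers generated (hashed) in an execution. -/
def generated (T : Table κ) : Finset (Header κ) :=
  (T.filterMap fun e => match e.1 with
    | .header h => some h
    | _ => none).toFinset

/-- The cumulative work of the valid malicious blocks generated in an execution. -/
def maliciousWork (R : Consensus κ) (o : Outcome κ) (T : Table κ) : ℕ :=
  ∑ h ∈ (generated T).filter fun h => h ∉ o.honest ∧ h ≠ R.genesis ∧ ValidBlock R T h, h.difficulty

/-- The claimed chain, of length `n` with the presented tip, is valid. -/
def ChainValid (R : Consensus κ) (n : ℕ) (o : Outcome κ) (T : Table κ) : Prop :=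
  ∃ C, ValidChain R T C ∧ C.length = n ∧ C.head? = o.com.headers.head?

/-- `min {ν | ∑_{i = n - ν + 1}^n d_i ≥ x}` for the list of difficulties `d_n, d_{n-1}, …`;
`⊤` if there is no such `ν`. -/
def minSuffix (d : List ℕ) (x : ℝ) : ℕ∞ :=
  ⨅ ν ∈ {ν : ℕ | ν ≤ d.length ∧ x ≤ ((d.take ν).sum : ℕ)}, (ν : ℕ∞)

/-- Negligible functions of the security parameter. -/
def Negligible (f : ℕ → ℝ) : Prop :=
  Asymptotics.SuperpolynomialDecay Filter.atTop (fun lam : ℕ => (lam : ℝ)) f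

section Families

variable {κ : ℕ → ℕ}

/-- Polynomially many hash evaluations are made in the executions. -/
def PolyBounded (G : ∀ lam, Prog (κ lam) (Outcome (κ lam))) : Prop :=
  ∃ p : Polynomial ℕ, ∀ lam, ∀ x ∈ (law (G lam)).support, x.2.length ≤ p.eval lam

/-- Honest miners only generate blocks that extend a valid chain. -/
def HonestMining (R : ∀ lam, Consensus (κ lam)) (G : ∀ lam, Prog (κ lam) (Outcome (κ lam))) :
    Prop :=
  ∀ lam, ∀ x ∈ (law (G lam)).support, ∀ h ∈ x.1.honest, ∃ C, ValidChain (R lam) x.2 (h :: C)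

/-- The attacker is a `w`-adversary in these executions: the valid malicious blocks have at most `w`
cumulative work, except with negligible probability. -/
def IsWorkAdversary (R : ∀ lam, Consensus (κ lam)) (w : ℕ → ℝ)
    (G : ∀ lam, Prog (κ lam) (Outcome (κ lam))) : Prop :=
  Negligible fun lam => prob (G lam) fun o T => w lam < maliciousWork (R lam) o T

/-- The verifier accepts an invalid chain only with negligible probability, where the parameters
`(c, L)` respect `L ≥ min {ν | ∑_{i = n - ν + 1}^n d_i ≥ w / c}` for the difficulties `d_i` of
the chain that is presented. -/
def Secure (R : ∀ lam, Consensus (κ lam)) (n : ℕ → ℕ) (c : ℕ → ℝ) (L : ℕ → ℕ) (w : ℕ → ℝ)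
    (G : ∀ lam, Prog (κ lam) (Outcome (κ lam))) : Prop :=
  Negligible fun lam => prob (G lam) fun o T =>
    minSuffix o.com.difficulties (w lam / c lam) ≤ (L lam : ℕ∞) ∧
    o.accepted = true ∧ ¬ ChainValid (R lam) (n lam) o T

end Families

end

end FlyClient

/-! The deterministic phase alone gives the bound. Suppose that it accepts and that no two recorded
hash inputs collide. If one of the last `L` headers were the end of a valid chain, then the
presented tip would be the end of a valid chain of length `n`. Indeed such a header commits to the
true MMR over its predecessors, and its ancestry proof identifies this MMR with the left part of the
one under the tip. From there the ancestry proofs of the following headers force each of them to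
commit to the MMR extended by its predecessor, while links, proofs of work and difficulties are
checked directly (`DetChecked.exists_validChain`, resting on `Opens.peaks_append`).

Hence, if the presented chain is invalid, none of the last `L` headers is honest. They are valid
blocks, and pairwise distinct because a commitment fixes the height, so their work is at most the
malicious work (`DetChecked.le_maliciousWork`). The condition on `L` makes their work at least `w /
c`, so the malicious work is positive and at least `w / c`, hence exceeds `w`. For a `w`-adversary
this has negligible probability.

Collisions add at most `q ^ 2 / 2 ^ κ` for `q` hash evaluations (`prob_collision_le`). Everything
else is deterministic: `Prog.Returns` replays an execution against its final table. -/

namespace FlyClient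

open Classical

variable {κ : ℕ} {α β : Type}

/-! ### Replaying executions against a fixed table -/

/-- All recorded hashes of `T` are recorded in `T'`. -/
def Table.Extends (T T' : Table κ) : Prop :=
  ∀ x d, T.get x = some d → T'.get x = some d

/-- The recorded hashes have no collisions. -/
def Table.CollisionFree (T : Table κ) : Prop :=
  ∀ x y d, T.get x = some d → T.get y = some d → x = y

theorem Table.get_cons (T : Table κ) (x y : HashInput κ) (d : Digest κ) :
    Table.get ((x, d) :: T) y = if x = y then some d else T.get y := by
  unfold Table.get
  by_cases h : x = y <;> simp [h]

theorem Table.Extends.refl (T : Table κ) : T.Extends T := fun _ _ h => h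

theorem Table.Extends.trans {T T' T'' : Table κ} (h : T.Extends T') (h' : T'.Extends T'') :
    T.Extends T'' := fun x d hx => h' x d (h x d hx)

theorem Table.extends_cons {T : Table κ} {x : HashInput κ} (h : T.get x = none) (d : Digest κ) :
    T.Extends ((x, d) :: T) := by
  intro y e hy
  rw [Table.get_cons, if_neg, hy]
  rintro rfl
  simp [h] at hy

/-- The program can return `a` when its hash evaluations are answered from `T`. -/
def Prog.Returns (T : Table κ) : Prog κ α → α → Prop
  | .pure b, a => a = b
  | .hash x k, a => ∃ d, T.get x = some d ∧ (k d).Returns T a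
  | .sample _ k, a => ∃ i, (k i).Returns T a

@[simp]
theorem Prog.returns_pure {T : Table κ} {a b : α} :
    Prog.Returns T (Pure.pure b : Prog κ α) a ↔ a = b := Iff.rfl

@[simp]
theorem Prog.returns_ask {T : Table κ} {x : HashInput κ} {d : Digest κ} :
    (Prog.ask x).Returns T d ↔ T.get x = some d := by
  constructor
  · rintro ⟨e, he, rfl⟩
    exact he
  · exact fun h => ⟨d, h, rfl⟩

@[simp]
theorem Prog.returns_bind {T : Table κ} (G : Prog κ α) (f : α → Prog κ β) (b : β) :
    (G >>= f).Returns T b ↔ ∃ a, G.Returns T a ∧ (f a).Returns T b := by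
  change (G.bind f).Returns T b ↔ _
  induction G with
  | pure a => simp [Prog.bind, Prog.Returns]
  | hash x k ih =>
    simp only [Prog.bind, Prog.Returns, ih]
    exact ⟨fun ⟨d, h, a, h₁, h₂⟩ => ⟨a, ⟨d, h, h₁⟩, h₂⟩,
      fun ⟨a, ⟨d, h, h₁⟩, h₂⟩ => ⟨d, h, a, h₁, h₂⟩⟩
  | sample p k ih =>
    simp only [Prog.bind, Prog.Returns, ih]
    exact ⟨fun ⟨d, a, h₁, h₂⟩ => ⟨a, ⟨d, h₁⟩, h₂⟩, fun ⟨a, ⟨d, h₁⟩, h₂⟩ => ⟨d, a, h₁, h₂⟩⟩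

theorem Prog.extends_of_mem_support (G : Prog κ α) {T : Table κ} {y : α × Table κ}
    (h : y ∈ (G.run T).support) : T.Extends y.2 ∧ T.length ≤ y.2.length := by
  induction G generalizing T with
  | pure a =>
    simp only [Prog.run, PMF.support_pure, Set.mem_singleton_iff] at h
    subst h
    exact ⟨Table.Extends.refl T, le_rfl⟩
  | hash x k ih =>
    rw [Prog.run] at h
    split at h
    · exact ih _ h
    · rename_i hx
      rw [PMF.mem_support_bind_iff] at h
      obtain ⟨d, -, hd⟩ := h
      obtain ⟨h₁, h₂⟩ := ih _ hd
      exact ⟨(Table.extends_cons hx d).trans h₁, by simp at h₂; omega⟩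
  | sample p k ih =>
    rw [Prog.run, PMF.mem_support_bind_iff] at h
    obtain ⟨i, -, hi⟩ := h
    exact ih _ hi

/-- Tables only grow, so every answer given during a run is still recorded at its end. This removes
probability from all later arguments: draws become existential quantifiers and the hash function
becomes one fixed partial function. -/
theorem Prog.returns_of_mem_support (G : Prog κ α) {T : Table κ} {y : α × Table κ}
    (h : y ∈ (G.run T).support) : G.Returns y.2 y.1 := by
  induction G generalizing T with
  | pure a =>
    simp only [Prog.run, PMF.support_pure, Set.mem_singleton_iff] at h
    subst h
    exact rfl
  | hash x k ih =>
    rw [Prog.run] at h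
    split at h
    · rename_i d hx
      exact ⟨d, ((k d).extends_of_mem_support h).1 _ _ hx, ih _ h⟩
    · rw [PMF.mem_support_bind_iff] at h
      obtain ⟨d, -, hd⟩ := h
      exact ⟨d, ((k d).extends_of_mem_support hd).1 _ _ (by simp [Table.get_cons]), ih _ hd⟩
  | sample p k ih =>
    rw [Prog.run, PMF.mem_support_bind_iff] at h
    obtain ⟨i, -, hi⟩ := h
    exact ⟨i, ih _ hi⟩

/-! ## The probability of a hash collision -/

theorem Table.CollisionFree.cons {T : Table κ} (hT : T.CollisionFree) {x : HashInput κ}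
    {d : Digest κ} (hd : d ∉ T.map Prod.snd) : Table.CollisionFree ((x, d) :: T) := by
  have key : ∀ y, T.get y ≠ some d := by
    intro y hy
    simp only [Table.get, Option.map_eq_some_iff] at hy
    obtain ⟨e, he, rfl⟩ := hy
    exact hd (List.mem_map_of_mem (List.mem_of_find?_eq_some he))
  intro y z e hy hz
  rw [Table.get_cons] at hy hz
  split_ifs at hy hz with h₁ h₂ h₂
  · exact h₁.symm.trans h₂
  · cases hy
    exact absurd hz (key z)
  · cases hz
    exact absurd hy (key y)
  · exact hT y z e hy hz

open scoped ENNReal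

theorem toOuterMeasure_le_one (p : PMF β) (s : Set β) : p.toOuterMeasure s ≤ 1 := by
  rw [← (p.toOuterMeasure_apply_eq_one_iff Set.univ).2 (Set.subset_univ _)]
  exact MeasureTheory.measure_mono (Set.subset_univ s)

/-- A union bound: the bad values `l` carry mass at most `q / card ι` and are bounded trivially by
`1`; the others contribute at most `b` on average. -/
theorem toOuterMeasure_bind_uniform_le {ι : Type} [Fintype ι] [Nonempty ι] (f : ι → PMF β)
    (s : Set β) (l : List ι) (q : ℕ) (hl : l.length ≤ q) (b : ℝ≥0∞)
    (h : ∀ d, d ∉ l → (f d).toOuterMeasure s ≤ b) :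
    ((PMF.uniformOfFintype ι).bind f).toOuterMeasure s ≤ q * (Fintype.card ι : ℝ≥0∞)⁻¹ + b := by
  rw [PMF.toOuterMeasure_bind_apply]
  calc ∑' d, PMF.uniformOfFintype ι d * (f d).toOuterMeasure s
      ≤ ∑' d, ((if d ∈ l.toFinset then (Fintype.card ι : ℝ≥0∞)⁻¹ else 0) +
          PMF.uniformOfFintype ι d * b) := by
        refine ENNReal.tsum_le_tsum fun d => ?_
        by_cases hd : d ∈ l
        · simp only [List.mem_toFinset, hd, if_true]
          refine le_add_right ?_
          rw [PMF.uniformOfFintype_apply]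
          exact mul_le_of_le_one_right' (toOuterMeasure_le_one _ _)
        · simp only [List.mem_toFinset, hd, if_false, zero_add]
          gcongr
          exact h d hd
    _ = (l.toFinset.card : ℝ≥0∞) * (Fintype.card ι : ℝ≥0∞)⁻¹ + b := by
        rw [ENNReal.tsum_add, ENNReal.tsum_mul_right, PMF.tsum_coe, one_mul, tsum_fintype,
          Finset.sum_ite_mem, Finset.univ_inter, Finset.sum_const, nsmul_eq_mul]
    _ ≤ q * (Fintype.card ι : ℝ≥0∞)⁻¹ + b := by
        gcongr
        exact l.toFinset_card_le.trans hl

/-- The birthday bound. Only fresh queries lengthen the table, so at most `q - T.length` of them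
remain, and each hits one of at most `q` recorded digests with probability at most `q / 2 ^ κ`. -/
theorem Prog.toOuterMeasure_collision_le (G : Prog κ α) (q : ℕ) {T : Table κ}
    (hT : T.CollisionFree) (hq : ∀ y ∈ (G.run T).support, y.2.length ≤ q) :
    (G.run T).toOuterMeasure {y | ¬ y.2.CollisionFree} ≤
      ((q - T.length : ℕ) : ℝ≥0∞) * (q * ((2 ^ κ : ℕ) : ℝ≥0∞)⁻¹) := by
  induction G generalizing T with
  | pure a =>
    refine le_trans (le_of_eq ?_) zero_le
    rw [PMF.toOuterMeasure_apply_eq_zero_iff, Set.disjoint_left]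
    intro y hy
    simp only [Prog.run, PMF.support_pure, Set.mem_singleton_iff] at hy
    subst hy
    simpa using hT
  | hash x k ih =>
    cases hx : T.get x with
    | some d =>
      have hrun : (Prog.hash x k).run T = (k d).run T := by simp only [Prog.run, hx]
      rw [hrun] at hq ⊢
      exact ih _ hT hq
    | none =>
      have hrun : (Prog.hash x k).run T = (PMF.uniformOfFintype (Digest κ)).bind
          fun d => (k d).run ((x, d) :: T) := by simp only [Prog.run, hx]
      rw [hrun] at hq ⊢
      have hsupp : ∀ d, ∀ y ∈ ((k d).run ((x, d) :: T)).support, y.2.length ≤ q := fun d y hy =>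
        hq y ((PMF.mem_support_bind_iff _ _ _).2 ⟨d, PMF.mem_support_uniformOfFintype d, hy⟩)
      -- The truncated subtraction `q - T.length` has to drop by exactly one; any run in the support
      -- shows that there is room for this query.
      have hlen : T.length + 1 ≤ q := by
        obtain ⟨y, hy⟩ := ((k 0).run ((x, 0) :: T)).support_nonempty
        exact ((k 0).extends_of_mem_support hy).2.trans (hsupp 0 y hy)
      refine (toOuterMeasure_bind_uniform_le _ _ (T.map Prod.snd) q (by rw [List.length_map]; omega)
        (((q - (T.length + 1) : ℕ) : ℝ≥0∞) * (q * ((2 ^ κ : ℕ) : ℝ≥0∞)⁻¹))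
        fun d hd => ih d (hT.cons hd) (hsupp d)).trans (le_of_eq ?_)
      have h₁ : q - T.length = q - (T.length + 1) + 1 := by omega
      rw [h₁, Fintype.card_fin]
      push_cast
      ring
  | sample p k ih =>
    rw [Prog.run] at hq ⊢
    rw [PMF.toOuterMeasure_bind_apply]
    calc _ ≤ ∑' i, p i * (((q - T.length : ℕ) : ℝ≥0∞) * (q * ((2 ^ κ : ℕ) : ℝ≥0∞)⁻¹)) := by
          refine ENNReal.tsum_le_tsum fun i => ?_
          by_cases hi : p i = 0
          · simp [hi]
          · gcongr
            exact ih i hT fun y hy => hq y ((PMF.mem_support_bind_iff _ _ _).2 ⟨i, hi, hy⟩)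
      _ = _ := by rw [ENNReal.tsum_mul_right, PMF.tsum_coe, one_mul]

theorem prob_collision_le (G : Prog κ (Outcome κ)) (q : ℕ)
    (hq : ∀ x ∈ (law G).support, x.2.length ≤ q) :
    prob G (fun _ T => ¬ T.CollisionFree) ≤ q * q * (1 / 2) ^ κ := by
  have h := Prog.toOuterMeasure_collision_le G q (T := []) (fun x y d hx => by cases hx) hq
  have h' := ENNReal.toReal_mono (by finiteness) h
  refine h'.trans (le_of_eq ?_)
  simp [mul_assoc]

theorem prob_le_add (G : Prog κ (Outcome κ)) {E F F' : Outcome κ → Table κ → Prop}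
    (h : ∀ x ∈ (law G).support, E x.1 x.2 → F x.1 x.2 ∨ F' x.1 x.2) :
    prob G E ≤ prob G F + prob G F' := by
  have fin : ∀ s, (law G).toOuterMeasure s ≠ ⊤ := fun s => ne_top_of_le_ne_top (by simp) (toOuterMeasure_le_one _ _)
  unfold prob
  rw [← ENNReal.toReal_add (fin _) (fin _)]
  refine ENNReal.toReal_mono (ENNReal.add_ne_top.2 ⟨fin _, fin _⟩) ?_
  refine le_trans ?_ (MeasureTheory.measure_union_le _ _)
  exact PMF.toOuterMeasure_mono _ fun x hx => h x hx.2 hx.1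

theorem negligible_of_le {κ : ℕ → ℕ} (hκ : Negligible fun lam => (1 / 2 : ℝ) ^ κ lam)
    {f g : ℕ → ℝ} (hg : Negligible g) (hf : ∀ lam, 0 ≤ f lam) (p : Polynomial ℕ)
    (h : ∀ lam, f lam ≤ g lam + p.eval lam * p.eval lam * (1 / 2) ^ κ lam) : Negligible f := by
  unfold Negligible at *
  have h₁ := hg.add (hκ.polynomial_mul ((p * p).map (Nat.castRingHom ℝ)))
  refine h₁.trans_abs_le fun lam => ?_
  rw [abs_of_nonneg (hf lam)]
  refine le_trans (h lam) (le_trans (le_of_eq ?_) (le_abs_self _))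
  simp [Polynomial.eval_natCast_map]

variable {R : Consensus κ} {T : Table κ}

/-! ## Ancestry proofs -/

/-- Cutting an MMR off inside its right half does not move the first split. So the MMR over a prefix
shares its left subtrees with the whole one. -/
theorem mmrSplit_eq {N i : ℕ} (h : mmrSplit N < i) (h' : i ≤ N) : mmrSplit i = mmrSplit N := by
  unfold mmrSplit at *
  congr 1
  refine le_antisymm (Nat.log_mono_right (by omega)) ?_
  have := Nat.log_mono_right (b := 2) (show 2 ^ Nat.log 2 (N - 1) ≤ i - 1 by omega)
  rwa [Nat.log_pow (by norm_num)] at this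

theorem mmrRoot_singleton (s : ℕ) (h : Header κ) :
    mmrRoot T s [h] = (T.get (.header h)).map (leafNode s h) := by
  rw [mmrRoot]

theorem mmrRoot_eq_some_iff {s : ℕ} {C : List (Header κ)} (hC : 2 ≤ C.length) {r : MMRNode κ} :
    mmrRoot T s C = some r ↔ ∃ l q d, mmrRoot T s (C.take (mmrSplit C.length)) = some l ∧
      mmrRoot T (s + mmrSplit C.length) (C.drop (mmrSplit C.length)) = some q ∧
      T.get (.children l q) = some d ∧ r = parentNode l q d := by
  match C, hC with
  | h₁ :: h₂ :: t, _ =>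
    rw [mmrRoot]
    simp only [List.length_cons]
    constructor
    · intro h
      split at h
      · rename_i l q hl hq
        obtain ⟨d, hd, rfl⟩ := Option.map_eq_some_iff.1 h
        exact ⟨l, q, d, hl, hq, hd, rfl⟩
      · cases h
    · rintro ⟨l, q, d, hl, hq, hd, rfl⟩
      rw [hl, hq]
      simp [hd]

theorem mmrRoot_lastHeight {s : ℕ} {C : List (Header κ)} {r : MMRNode κ}
    (h : mmrRoot T s C = some r) : r.lastHeight + 1 = s + C.length := by
  induction hn : C.length using Nat.strong_induction_on generalizing s C r with
  | _ n ih =>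
    subst hn
    match C, h with
    | [], h => simp [mmrRoot] at h
    | [x], h =>
      rw [mmrRoot_singleton] at h
      obtain ⟨d, -, rfl⟩ := Option.map_eq_some_iff.1 h
      rfl
    | x :: y :: t, h =>
      have h2 : 2 ≤ (x :: y :: t).length := by simp
      obtain ⟨l, q, d, -, hq, -, rfl⟩ := (mmrRoot_eq_some_iff h2).1 h
      have h₁ := mmrSplit_pos (x :: y :: t).length
      have h₂ := mmrSplit_lt h2
      have := ih _ (by rw [List.length_drop]; omega) hq rfl
      rw [List.length_drop] at this
      simp only [parentNode]
      omega

/-- A parent node stores the hash of its pair of children, so equal parents give two preimages of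
one digest. -/
theorem parentNode_inj (hT : T.CollisionFree) {l q l' q' : MMRNode κ} {d d' : Digest κ}
    (h : T.get (.children l q) = some d) (h' : T.get (.children l' q') = some d')
    (e : parentNode l q d = parentNode l' q' d') : l = l' ∧ q = q' := by
  have hd : d = d' := congrArg MMRNode.hash e
  subst hd
  simpa using hT _ _ _ h h'

/-- With hashes from `T`, the leaf number `i` of an MMR with root node `r` over `N` headers, the
first one at height `s`, is `leaf`; the left siblings on the way to it are `lefts`. -/
inductive Opens (T : Table κ) (leaf : MMRNode κ) :
    (s N i : ℕ) → MMRNode κ → List (MMRNode κ) → Prop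
  | leaf (s : ℕ) : Opens T leaf s 1 0 leaf []
  | left {s N i : ℕ} {r l q : MMRNode κ} {d : Digest κ} {lefts : List (MMRNode κ)}
      (two_le : 2 ≤ N) (lt : i < mmrSplit N) (covers : q.Covers (s + mmrSplit N) (N - mmrSplit N))
      (opens : Opens T leaf s (mmrSplit N) i l lefts) (hash : T.get (.children l q) = some d)
      (eq : r = parentNode l q d) : Opens T leaf s N i r lefts
  | right {s N i : ℕ} {r l q : MMRNode κ} {d : Digest κ} {lefts : List (MMRNode κ)}
      (two_le : 2 ≤ N) (le : mmrSplit N ≤ i) (covers : l.Covers s (mmrSplit N))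
      (opens : Opens T leaf (s + mmrSplit N) (N - mmrSplit N) (i - mmrSplit N) q lefts)
      (hash : T.get (.children l q) = some d) (eq : r = parentNode l q d) :
      Opens T leaf s N i r (l :: lefts)

theorem opens_of_returns {leaf r : MMRNode κ} {sib lefts : List (MMRNode κ)} {s N i : ℕ}
    (hi : i < N) (h : (openPath R leaf sib s N i).Returns T (some (r, lefts))) :
    Opens T leaf s N i r lefts := by
  induction sib generalizing s N i r lefts with
  | nil =>
    simp only [openPath, Prog.returns_pure] at h
    split_ifs at h with hN
    · obtain rfl : i = 0 := by omega
      subst hN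
      simp only [Option.some.injEq, Prod.mk.injEq] at h
      obtain ⟨rfl, rfl⟩ := h
      exact .leaf s
  | cons q qs ih =>
    rw [openPath] at h
    split_ifs at h with h₁ h₂ h₃ h₃
    · simp at h
    · rw [Prog.returns_bind] at h
      obtain ⟨_ | ⟨l, lefts'⟩, hl, h⟩ := h
      · simp at h
      · simp only [Prog.returns_bind, Prog.returns_ask, Prog.returns_pure, Option.some.injEq,
          Prod.mk.injEq] at h
        obtain ⟨d, hd, rfl, rfl⟩ := h
        exact .left (by omega) h₂ h₃ (ih h₂ hl) hd rfl
    · simp at h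
    · rw [Prog.returns_bind] at h
      obtain ⟨_ | ⟨l, lefts'⟩, hl, h⟩ := h
      · simp at h
      · simp only [Prog.returns_bind, Prog.returns_ask, Prog.returns_pure, Option.some.injEq,
          Prod.mk.injEq] at h
        obtain ⟨d, hd, rfl, rfl⟩ := h
        exact .right (by omega) (by omega) h₃ (ih (by omega) hl) hd rfl
    · simp at h

/-- With hashes from `T`, the root node of the MMR with the given peaks is `p`. -/
inductive Bags (T : Table κ) : List (MMRNode κ) → MMRNode κ → Prop
  | single (p : MMRNode κ) : Bags T [p] p
  | cons {p q r : MMRNode κ} {ps : List (MMRNode κ)} {d : Digest κ} (bags : Bags T (q :: ps) r)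
      (hash : T.get (.children p r) = some d) : Bags T (p :: q :: ps) (parentNode p r d)

theorem bags_of_returns {ps : List (MMRNode κ)} {p : MMRNode κ}
    (h : (bagPeaks ps).Returns T (some p)) : Bags T ps p := by
  induction ps generalizing p with
  | nil => simp [bagPeaks] at h
  | cons a ps ih =>
    match ps with
    | [] =>
      simp only [bagPeaks, Prog.returns_pure, Option.some.injEq] at h
      subst h
      exact .single _
    | q :: ps =>
      rw [bagPeaks, Prog.returns_bind] at h
      obtain ⟨_ | r, hr, h⟩ := h
      · simp at h
      · simp only [Prog.returns_bind, Prog.returns_ask, Prog.returns_pure,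
          Option.some.injEq] at h
        obtain ⟨d, hd, rfl⟩ := h
        exact .cons (ih hr) hd

namespace Opens

variable {leaf leaf' r : MMRNode κ} {lefts lefts' : List (MMRNode κ)} {s N i : ℕ}

theorem lt (h : Opens T leaf s N i r lefts) : i < N := by
  induction h with
  | leaf => omega
  | left two_le _ _ _ _ _ ih => have := mmrSplit_lt two_le; omega
  | right two_le _ _ _ _ _ ih => omega

/-- Every right turn records a left sibling, and only the path to leaf `0` has no right turn. -/
theorem lefts_eq_nil_iff (h : Opens T leaf s N i r lefts) : lefts = [] ↔ i = 0 := by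
  induction h with
  | leaf => simp
  | left _ _ _ _ _ _ ih => exact ih
  | @right _ N _ _ _ _ _ _ _ le _ _ _ _ _ =>
    have := mmrSplit_pos N
    simp only [reduceCtorEq, false_iff]
    omega

theorem root_lastHeight (h : Opens T leaf s N i r lefts) (hl : leaf.lastHeight = s + i) :
    r.lastHeight + 1 = s + N := by
  induction h with
  | leaf => omega
  | left two_le _ covers _ _ eq ih =>
    have := mmrSplit_lt two_le
    have := covers.2
    subst eq
    simp only [parentNode]
    omega
  | right two_le _ covers _ _ eq ih =>
    have := mmrSplit_lt two_le
    subst eq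
    simp only [parentNode]
    have := ih (by omega)
    omega

/-- The bagged node takes its last height from the last peak, where the range check `covers` forces
it to end just before leaf `i`. Thus a header's MMR commitment determines its height. -/
theorem bag_lastHeight (h : Opens T leaf s N i r lefts) {p : MMRNode κ} (hp : Bags T lefts p) :
    p.lastHeight + 1 = s + i := by
  induction h generalizing p with
  | leaf => cases hp
  | left _ _ _ _ _ _ ih => exact ih hp
  | right _ le covers opens _ _ ih =>
    cases hp with
    | single =>
      have := opens.lefts_eq_nil_iff.1 rfl
      have := covers.2
      omega
    | cons bags _ =>
      have := ih bags
      simp only [parentNode]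
      omega

end Opens

/-- `lefts` are the left siblings of leaf number `P.length` in an MMR over `N` headers,
the first one at height `s`, if the first ones are `P`. -/
inductive Peaks (T : Table κ) : (s N : ℕ) → List (Header κ) → List (MMRNode κ) → Prop
  | nil (s : ℕ) : Peaks T s 1 [] []
  | left {s N : ℕ} {P : List (Header κ)} {lefts : List (MMRNode κ)} (two_le : 2 ≤ N)
      (lt : P.length < mmrSplit N) (peaks : Peaks T s (mmrSplit N) P lefts) : Peaks T s N P lefts
  | right {s N : ℕ} {P : List (Header κ)} {l : MMRNode κ} {lefts : List (MMRNode κ)}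
      (two_le : 2 ≤ N) (le : mmrSplit N ≤ P.length)
      (root : mmrRoot T s (P.take (mmrSplit N)) = some l)
      (peaks : Peaks T (s + mmrSplit N) (N - mmrSplit N) (P.drop (mmrSplit N)) lefts) :
      Peaks T s N P (l :: lefts)

namespace Opens

variable {leaf leaf' r : MMRNode κ} {lefts lefts' : List (MMRNode κ)} {s N i : ℕ}

theorem peaks_nil (h : Opens T leaf s N 0 r lefts) : Peaks T s N [] lefts := by
  generalize hi : 0 = i at h
  induction h with
  | leaf => exact .nil _
  | left two_le lt _ _ _ _ ih => exact .left two_le (mmrSplit_pos _) (ih hi)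
  | @right _ N _ _ _ _ _ _ two_le le _ _ _ _ _ => have := mmrSplit_pos N; omega

/-- The entry point of the induction along the chain: if the siblings bag to a genuine MMR root over
`P`, undoing the bagging hash by hash shows that each sibling is a genuine subtree root. -/
theorem peaks_of_bags (hT : T.CollisionFree) (h : Opens T leaf s N i r lefts) {p : MMRNode κ}
    (hp : Bags T lefts p) {P : List (Header κ)} (hP : P.length = i)
    (hr : mmrRoot T s P = some p) : Peaks T s N P lefts := by
  induction h generalizing p P with
  | leaf => cases hp
  | left two_le lt _ _ _ _ ih => exact .left two_le (by omega) (ih hp hP hr)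
  | @right s N i _ _ _ _ _ two_le le covers opens _ _ ih =>
    cases hp with
    | single =>
      have hi := opens.lefts_eq_nil_iff.1 rfl
      have : P.length = mmrSplit N := by omega
      refine .right two_le (by omega) (by rwa [← this, List.take_length]) ?_
      rw [← this, List.drop_length, this]
      rw [hi] at opens
      exact opens.peaks_nil
    | cons bags hash =>
      have hi : i - mmrSplit N ≠ 0 := fun e => by simpa using opens.lefts_eq_nil_iff.2 e
      have hlt := opens.lt
      have hpos := mmrSplit_pos N
      obtain ⟨l, q, d, hl, hq, hd, e⟩ := (mmrRoot_eq_some_iff (by omega)).1 hr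
      rw [mmrSplit_eq (N := N) (by omega) (by omega)] at hl hq
      obtain ⟨rfl, rfl⟩ := parentNode_inj hT hash hd e
      exact .right two_le (by omega) hl (ih bags (by rw [List.length_drop]; omega) hq)

end Opens

theorem Peaks.eq_nil_iff {s N : ℕ} {P : List (Header κ)} {lefts : List (MMRNode κ)}
    (h : Peaks T s N P lefts) : lefts = [] ↔ P = [] := by
  induction h with
  | nil => simp
  | left _ _ _ ih => exact ih
  | @right _ N P _ _ _ le _ _ _ =>
    have := mmrSplit_pos N
    simp only [reduceCtorEq, false_iff]
    rintro rfl
    simp at le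
    omega

/-- By `mmrSplit_eq`, the recursion of `mmrRoot` on the prefix splits where the path in the large
MMR turns right, so bagging retraces it. -/
theorem Peaks.mmrRoot_eq {s N : ℕ} {P : List (Header κ)} {lefts : List (MMRNode κ)}
    (h : Peaks T s N P lefts) (hN : P.length < N) {p : MMRNode κ} (hp : Bags T lefts p) :
    mmrRoot T s P = some p := by
  induction h generalizing p with
  | nil => cases hp
  | left _ lt _ ih => exact ih lt hp
  | @right s N P l lefts two_le le root peaks ih =>
    have hpos := mmrSplit_pos N
    have hlen : (P.drop (mmrSplit N)).length = P.length - mmrSplit N := List.length_drop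
    cases hp with
    | single =>
      have h : P.length = mmrSplit N := by
        have := peaks.eq_nil_iff.1 rfl
        rw [List.drop_eq_nil_iff] at this
        omega
      rwa [← h, List.take_length] at root
    | cons bags hash =>
      have h : P.length ≠ mmrSplit N := fun e => by
        simpa using peaks.eq_nil_iff.2 (List.drop_of_length_le e.le)
      refine (mmrRoot_eq_some_iff (by omega)).2 ?_
      rw [mmrSplit_eq (N := N) (by omega) (by omega)]
      exact ⟨_, _, _, root, ih (by omega) bags, hash, rfl⟩

/-- Consecutive leaves: the peaks before the second one, or the root if there is none. -/
theorem Opens.peaks_append (hT : T.CollisionFree) {x : Header κ} {d : Digest κ} {s N : ℕ}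
    {r : MMRNode κ} {lefts : List (MMRNode κ)} {P : List (Header κ)}
    (hd : T.get (.header x) = some d)
    (h : Opens T (leafNode (s + P.length) x d) s N P.length r lefts) (hP : Peaks T s N P lefts) :
    (P.length + 1 = N → mmrRoot T s (P ++ [x]) = some r) ∧
    ∀ leaf' lefts', Opens T leaf' s N (P.length + 1) r lefts' →
      Peaks T s N (P ++ [x]) lefts' := by
  generalize hi : P.length = i at h
  generalize hx : leafNode (s + i) x d = leaf at h
  induction h generalizing P with
  | leaf s =>
    have : P = [] := List.length_eq_zero_iff.1 hi
    subst this
    subst hx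
    refine ⟨fun _ => by simp [mmrRoot_singleton, hd], fun _ _ h => ?_⟩
    have := h.lt
    omega
  | @left s N i r l q e lefts two_le lt covers opens hash eq ih =>
    have hlt := mmrSplit_lt two_le
    have hP' : Peaks T s (mmrSplit N) P lefts := by
      cases hP with
      | nil => omega
      | left _ _ h => exact h
      | right _ le => omega
    obtain ⟨ih₁, ih₂⟩ := ih hP' hi hx
    refine ⟨fun _ => by omega, fun leaf' lefts' h => ?_⟩
    subst eq
    cases h with
    | left _ lt' covers' opens' hash' eq' =>
      obtain ⟨rfl, rfl⟩ := parentNode_inj hT hash hash' eq'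
      exact .left two_le (by simp; omega) (ih₂ _ _ opens')
    -- The paths part here: `x` is the last leaf of the left half, which is now complete, so its
    -- root is the new peak and the next leaf is number `0` of the right half.
    | right _ le' covers' opens' hash' eq' =>
      obtain ⟨rfl, rfl⟩ := parentNode_inj hT hash hash' eq'
      have hlen : (P ++ [x]).length = mmrSplit N := by simp; omega
      refine .right two_le hlen.ge ?_ ?_
      · rw [← hlen, List.take_length]
        exact ih₁ (by omega)
      · rw [← hlen, List.drop_length, hlen]
        rw [show i + 1 - mmrSplit N = 0 by omega] at opens'
        exact opens'.peaks_nil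
  | @right s N i r l q e lefts two_le le covers opens hash eq ih =>
    have hlt := mmrSplit_lt two_le
    have hpos := mmrSplit_pos N
    have hlen : (P.drop (mmrSplit N)).length = i - mmrSplit N := by rw [List.length_drop, hi]
    cases hP with
    | left _ lt => omega
    | right _ _ root peaks =>
      obtain ⟨ih₁, ih₂⟩ := ih peaks hlen (by rw [← hx]; congr 1; omega)
      have htake : (P ++ [x]).take (mmrSplit N) = P.take (mmrSplit N) :=
        List.take_append_of_le_length (by omega)
      have hdrop : (P ++ [x]).drop (mmrSplit N) = P.drop (mmrSplit N) ++ [x] :=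
        List.drop_append_of_le_length (by omega)
      constructor
      · intro hN
        have hl : (P ++ [x]).length = N := by simp; omega
        refine (mmrRoot_eq_some_iff (by omega)).2 ?_
        rw [hl, htake, hdrop]
        exact ⟨l, q, e, root, ih₁ (by omega), hash, eq⟩
      · intro leaf' lefts' h
        subst eq
        cases h with
        | left _ lt' => omega
        | right _ le' covers' opens' hash' eq' =>
          obtain ⟨rfl, rfl⟩ := parentNode_inj hT hash hash' eq'
          refine .right two_le (by simp; omega) (by rw [htake]; exact root) ?_
          rw [hdrop]
          refine ih₂ leaf' _ ?_
          rwa [show i - mmrSplit N + 1 = i + 1 - mmrSplit N by omega]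

/-! ## The deterministic phase -/

/-- The header `x` contains the hash of the header `y`. -/
def Linked (T : Table κ) (x y : Header κ) : Prop :=
  ∃ e, T.get (.header y) = some e ∧ x.prevHash = some e

/-- The header `h` commits to the MMR with root node `p`. -/
def Commits (T : Table κ) (h : Header κ) (p : MMRNode κ) : Prop :=
  ∃ e, T.get (.root p) = some e ∧ h.historyRoot = some e

theorem Commits.eq (hT : T.CollisionFree) {h : Header κ} {p q : MMRNode κ} (hp : Commits T h p)
    (hq : Commits T h q) : p = q := by
  obtain ⟨e, hp, he⟩ := hp
  obtain ⟨f, hq, hf⟩ := hq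
  rw [he] at hf
  cases hf
  simpa using hT _ _ _ hp hq

/-- The ancestry proof of the header `h` at height `i` was checked with respect to `root`. -/
def AncestryOk (T : Table κ) (root : MMRNode κ) (N i : ℕ) (h : Header κ) : Prop :=
  ∃ d lefts, T.get (.header h) = some d ∧ Opens T (leafNode i h d) 0 N i root lefts ∧
    (0 < i → ∃ p, Bags T lefts p ∧ Commits T h p)

theorem ancestryOk_of_returns {root : MMRNode κ} {N i : ℕ} {h : Header κ} {d : Digest κ}
    {sib : List (MMRNode κ)} {w : ℕ} (hd : T.get (.header h) = some d)
    (hr : (checkAncestry R root N i h d sib).Returns T (some w)) : AncestryOk T root N i h := by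
  unfold checkAncestry at hr
  by_cases hi : i < N
  · rw [if_pos hi, Prog.returns_bind] at hr
    obtain ⟨_ | ⟨r, lefts⟩, ho, hr⟩ := hr
    · simp at hr
    · dsimp only at hr
      by_cases h₁ : r = root
      · subst h₁
        refine ⟨d, lefts, hd, opens_of_returns hi ho, fun hpos => ?_⟩
        rw [if_neg (not_not.2 rfl), if_neg hpos.ne', Prog.returns_bind] at hr
        obtain ⟨_ | p, hp, hr⟩ := hr
        · simp at hr
        · simp only [Prog.returns_bind, Prog.returns_ask, Prog.returns_pure] at hr
          obtain ⟨e, he, hr⟩ := hr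
          split_ifs at hr with h₃
          exact ⟨p, bags_of_returns hp, e, he, h₃⟩
      · simp [h₁] at hr
  · simp [hi] at hr

theorem hashHeaders_returns {H : List (Header κ)} {hs : List (Header κ × Digest κ)}
    (h : (hashHeaders H).Returns T hs) :
    hs.map Prod.fst = H ∧ ∀ x ∈ hs, T.get (.header x.1) = some x.2 := by
  induction H generalizing hs with
  | nil =>
    simp only [hashHeaders, Prog.returns_pure] at h
    simp [h]
  | cons x H ih =>
    simp only [hashHeaders, Prog.returns_bind, Prog.returns_ask, Prog.returns_pure] at h
    obtain ⟨d, hd, ds, hds, rfl⟩ := h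
    obtain ⟨h₁, h₂⟩ := ih hds
    refine ⟨by simp [h₁], ?_⟩
    simpa [hd] using h₂

theorem checkAncestries_returns {root : MMRNode κ} {N : ℕ} {xs : List (Header κ × Digest κ)}
    {i : ℕ} {sibs : List (List (MMRNode κ))} (hxs : ∀ x ∈ xs, T.get (.header x.1) = some x.2)
    (h : (checkAncestries R root N i xs sibs).Returns T true) (k : ℕ) (hk : k < xs.length) :
    AncestryOk T root N (i - k) xs[k].1 := by
  induction xs generalizing i sibs k with
  | nil => simp at hk
  | cons x xs ih =>
    cases sibs with
    | nil => simp [checkAncestries] at h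
    | cons sib sibs =>
      simp only [checkAncestries, Prog.returns_bind, Prog.returns_pure] at h
      obtain ⟨a, ha, b, hb, h⟩ := h
      rw [eq_comm, Bool.and_eq_true] at h
      obtain ⟨h₁, rfl⟩ := h
      obtain ⟨w, rfl⟩ := Option.isSome_iff_exists.1 h₁
      cases k with
      | zero => exact ancestryOk_of_returns (hxs x (by simp)) ha
      | succ k =>
        have := ih (fun y hy => hxs y (by simp [hy])) hb k (by simpa using hk)
        simpa [Nat.sub_sub, add_comm] using this

theorem BlocksOk.getElem {m i : ℕ} {hs : List (Header κ × Digest κ)} (h : BlocksOk R m i hs)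
    (j : ℕ) (hj : j < hs.length) :
    (j < i → j < m → R.PowValid hs[j].1 hs[j].2 ∧
      R.difficultyRule (((hs.map Prod.fst).drop (j + 1)).take R.window) hs[j].1) ∧
    (j = i → hs[j].1 = R.genesis) := by
  induction hs generalizing m i j with
  | nil => simp at hj
  | cons x t ih =>
    cases i with
    | zero =>
      simp only [BlocksOk] at h
      obtain ⟨h, rfl⟩ := h
      obtain rfl : j = 0 := by simpa using hj
      simp [h]
    | succ i =>
      simp only [BlocksOk] at h
      cases j with
      | zero => simpa using h.1
      | succ j =>
        obtain ⟨h₁, h₂⟩ := ih h.2 j (by simpa using hj)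
        refine ⟨fun hi hm => ?_, fun hi => ?_⟩
        · simpa using h₁ (by omega) (by omega)
        · simpa using h₂ (by omega)

/-- The headers `H`, tip first, passed the deterministic phase with MMR root node `root`. -/
structure DetChecked (R : Consensus κ) (T : Table κ) (n L : ℕ) (root : MMRNode κ)
    (H : List (Header κ)) : Prop where
  length_eq : H.length = min n (L + 1 + R.window)
  commits : ∀ h : 0 < H.length, Commits T H[0] root
  linked : List.IsChain (Linked T) H
  block : ∀ j, ∀ h : j < H.length, j ≤ L → j + 1 < n → ∃ d, T.get (.header H[j]) = some d ∧
    R.PowValid H[j] d ∧ R.difficultyRule ((H.drop (j + 1)).take R.window) H[j]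
  genesis : ∀ j, ∀ h : j < H.length, j + 1 = n → H[j] = R.genesis
  ancestry : ∀ j, ∀ h : j < H.length, 0 < j → j ≤ L →
    AncestryOk T root (n - 1) (n - 1 - j) H[j]

theorem detChecked_of_returns {n L : ℕ} {com : Commitment κ}
    (h : (checkDet R n L com).Returns T true) : DetChecked R T n L com.root com.headers := by
  simp only [checkDet, Prog.returns_bind, Prog.returns_ask, Prog.returns_pure] at h
  obtain ⟨hs, hhs, e, he, b, hb, h⟩ := h
  rw [eq_comm, Bool.and_eq_true, decide_eq_true_iff] at h
  obtain ⟨rfl, hlen, htip, hlink, hok⟩ := h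
  obtain ⟨hmap, hget⟩ := hashHeaders_returns hhs
  generalize com.headers = H at *
  subst hmap
  rw [List.length_map] at hlen
  refine ⟨by rwa [List.length_map], fun h => ⟨e, he, ?_⟩, ?_, ?_, ?_, ?_⟩
  · cases hs with
    | nil => simp at h
    | cons x t => simpa using htip
  · rw [List.isChain_map]
    refine hlink.imp_of_mem_imp ?_
    intro x y _ hy hxy
    exact ⟨y.2, hget y hy, hxy⟩
  · intro j hj hjL hjn
    rw [List.length_map] at hj
    simp only [List.getElem_map]
    exact ⟨_, hget _ (List.getElem_mem hj), (hok.getElem j hj).1 (by omega) (by omega)⟩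
  · intro j hj hjn
    rw [List.length_map] at hj
    simp only [List.getElem_map]
    exact (hok.getElem j hj).2 (by omega)
  · intro j hj hj0 hjL
    rw [List.length_map] at hj
    -- The list of opened headers omits the tip and starts at height `n - 2`, so `H[j]` stands at
    -- position `j - 1`.
    have := checkAncestries_returns (fun x hx => hget x
      (List.mem_of_mem_drop (List.mem_of_mem_take hx))) hb (j - 1) (by simp; omega)
    simp only [List.getElem_take, List.getElem_drop] at this
    simp only [List.getElem_map]
    simpa [show 1 + (j - 1) = j by omega, show n - 2 - (j - 1) = n - 1 - j by omega] using this

/-! ### Validity propagates from a checked header to the tip -/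

/-- Without collisions the previous hash determines the previous header, so two backward chains from
`x` can differ only in length. -/
theorem Linked.isPrefix (hT : T.CollisionFree) {x : Header κ} {A B : List (Header κ)}
    (hA : List.IsChain (Linked T) (x :: A)) (hB : List.IsChain (Linked T) (x :: B)) :
    A <+: B ∨ B <+: A := by
  induction A generalizing x B with
  | nil => exact .inl List.nil_prefix
  | cons a A ih =>
    cases B with
    | nil => exact .inr List.nil_prefix
    | cons b B =>
      rw [List.isChain_cons_cons] at hA hB
      obtain ⟨⟨e, ha, he⟩, hA⟩ := hA
      obtain ⟨⟨f, hb, hf⟩, hB⟩ := hB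
      rw [he] at hf
      cases hf
      obtain rfl : a = b := by simpa using hT _ _ _ ha hb
      simpa [List.cons_prefix_cons] using ih hA hB

theorem take_eq_of_isPrefix {ι : Type} {A B : List ι} (h : A <+: B ∨ B <+: A) {m : ℕ}
    (hm : A.length = B.length ∨ m ≤ A.length ∧ m ≤ B.length) : A.take m = B.take m := by
  wlog hAB : A <+: B generalizing A B
  · exact (this h.symm (by omega) (h.resolve_left hAB)).symm
  · obtain ⟨D, rfl⟩ := hAB
    rcases hm with hm | hm
    · obtain rfl : D = [] := by simpa using hm
      simp
    · rw [List.take_append_of_le_length hm.1]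

theorem ValidChain.linked {C : List (Header κ)} (h : ValidChain R T C) :
    List.IsChain (Linked T) C := by
  induction h with
  | genesis => simp
  | extend _ hash_prev linked _ _ _ _ _ _ ih =>
    rw [List.isChain_cons_cons]
    exact ⟨⟨_, hash_prev, linked⟩, ih⟩

theorem ValidChain.exists_mmrRoot {h : Header κ} {C : List (Header κ)}
    (hv : ValidChain R T (h :: C)) (hg : h ≠ R.genesis) :
    ∃ r, mmrRoot T 0 C.reverse = some r ∧ Commits T h r := by
  cases hv with
  | genesis => exact absurd rfl hg
  | extend _ _ _ _ _ _ root_eq hash_root committed => exact ⟨_, root_eq, _, hash_root, committed⟩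

namespace DetChecked

variable {n L : ℕ} {root : MMRNode κ} {H : List (Header κ)}

theorem lt_length (h : DetChecked R T n L root H) (hLn : L < n) : L < H.length := by
  rw [h.length_eq]
  omega

theorem linked_getElem (h : DetChecked R T n L root H) (j : ℕ) (hj : j + 1 < H.length) :
    Linked T H[j] H[j + 1] :=
  List.isChain_iff_getElem.1 h.linked j hj

theorem ne_genesis (h : DetChecked R T n L root H) (hLn : L < n) (j : ℕ) (hj : j < L) :
    H[j]'(hj.trans (h.lt_length hLn)) ≠ R.genesis := by
  have := h.lt_length hLn
  obtain ⟨e, -, he⟩ := h.linked_getElem j (by omega)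
  intro hg
  rw [hg] at he
  cases he

theorem exists_commits (h : DetChecked R T n L root H) (hLn : L < n) (j : ℕ) (hj : j < L) :
    ∃ p, Commits T (H[j]'(hj.trans (h.lt_length hLn))) p ∧ p.lastHeight + 1 = n - 1 - j := by
  have hL := h.lt_length hLn
  cases j with
  | zero =>
    refine ⟨root, h.commits (by omega), ?_⟩
    obtain ⟨d, lefts, -, ho, -⟩ := h.ancestry 1 (by omega) one_pos (by omega)
    simpa using ho.root_lastHeight (by simp [leafNode])
  | succ j =>
    obtain ⟨d, lefts, -, ho, hp⟩ := h.ancestry (j + 1) (by omega) (by omega) (by omega)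
    obtain ⟨p, hp, hc⟩ := hp (by omega)
    exact ⟨p, hc, by simpa using ho.bag_lastHeight hp⟩

/-- Validity of the chain up to one of the checked headers implies validity up to the tip. -/
theorem exists_validChain (hT : T.CollisionFree) (h : DetChecked R T n L root H) (hLn : L < n)
    (j : ℕ) (hj : j < H.length) (hjL : j ≤ L) {C : List (Header κ)}
    (hv : ValidChain R T (H[j] :: C)) (hC : C.length = n - 1 - j)
    (hp : 0 < j → ∃ d lefts, T.get (.header H[j]) = some d ∧
      Opens T (leafNode (n - 1 - j) H[j] d) 0 (n - 1) (n - 1 - j) root lefts ∧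
      Peaks T 0 (n - 1) C.reverse lefts) :
    ∃ C, ValidChain R T C ∧ C.length = n ∧ C.head? = H.head? := by
  -- The tip is not a leaf of the MMR it commits to, so the invariant on openings and peaks is
  -- carried only for `0 < j`.
  induction j generalizing C with
  | zero =>
    exact ⟨_, hv, by simp; omega, by simp [List.head?_eq_getElem?, List.getElem?_eq_getElem hj]⟩
  | succ j ih =>
    obtain ⟨d, lefts, hd, ho, hpk⟩ := hp (by omega)
    obtain ⟨e, he, hpow, hdiff⟩ := h.block j (by omega) (by omega) (by omega)
    obtain ⟨dp, hdp, hlink⟩ := h.linked_getElem j hj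
    have hrev : C.reverse.length = n - 1 - (j + 1) := by simpa using hC
    have happ := Opens.peaks_append hT hd (s := 0) (by rw [hrev, zero_add]; exact ho) hpk
    rw [hrev, show C.reverse ++ [H[j + 1]] = (H[j + 1] :: C).reverse by simp] at happ
    -- The verifier judged the difficulty by the downloaded headers, validity refers to `C`. The two
    -- agree on the window: either both are long enough, or the download reaches height `0` and both
    -- have the same length.
    have hrule : ((H[j + 1] :: C).take R.window) = (H.drop (j + 1)).take R.window := by
      have hdrop : List.IsChain (Linked T) (H[j + 1] :: H.drop (j + 1 + 1)) := by
        rw [← List.drop_eq_getElem_cons]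
        exact h.linked.drop _
      rw [List.drop_eq_getElem_cons hj]
      have hpre := Linked.isPrefix hT hv.linked hdrop
      refine take_eq_of_isPrefix (by simpa only [List.cons_prefix_cons, true_and] using hpre) ?_
      have := h.length_eq
      simp only [List.length_cons, List.length_drop]
      omega
    suffices hnew : ∃ r, mmrRoot T 0 (H[j + 1] :: C).reverse = some r ∧ Commits T H[j] r ∧
        (0 < j → ∃ d lefts, T.get (.header H[j]) = some d ∧
          Opens T (leafNode (n - 1 - j) H[j] d) 0 (n - 1) (n - 1 - j) root lefts ∧
          Peaks T 0 (n - 1) (H[j + 1] :: C).reverse lefts) by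
      obtain ⟨r, hr, ⟨f, hf, hf'⟩, hpk'⟩ := hnew
      exact ih (by omega) (by omega)
        (.extend hv hdp hlink he hpow (hrule ▸ hdiff) hr hf hf') (by simp; omega) hpk'
    rcases Nat.eq_zero_or_pos j with rfl | hj0
    -- At the tip all `n - 1` leaves are filled, and the extended MMR is the whole one.
    · exact ⟨root, happ.1 (by omega), h.commits (by omega), fun h => by omega⟩
    · obtain ⟨d', lefts', hd', ho', hb'⟩ := h.ancestry j (by omega) hj0 (by omega)
      obtain ⟨p, hb, hc⟩ := hb' (by omega)
      have hpk' := happ.2 _ _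
        (by rwa [show n - 1 - (j + 1) + 1 = n - 1 - j by omega])
      exact ⟨p, hpk'.mmrRoot_eq (by simp; omega) hb, hc, fun _ => ⟨d', lefts', hd', ho', hpk'⟩⟩

/-- The valid chain below `H[j]` could a priori have any length and content. The commitment in
`H[j]` ties it to the checked ancestry proof, which yields both the height and the peaks that start
the induction. -/
theorem exists_validChain_of_validChain (hT : T.CollisionFree) (h : DetChecked R T n L root H)
    (hLn : L < n) (j : ℕ) (hj : j < L) {C : List (Header κ)}
    (hv : ValidChain R T (H[j]'(hj.trans (h.lt_length hLn)) :: C)) :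
    ∃ C, ValidChain R T C ∧ C.length = n ∧ C.head? = H.head? := by
  have hL := h.lt_length hLn
  obtain ⟨r, hr, hc⟩ := hv.exists_mmrRoot (h.ne_genesis hLn j hj)
  obtain ⟨p, hc', hp⟩ := h.exists_commits hLn j hj
  obtain rfl := hc.eq hT hc'
  have hC : C.length = n - 1 - j := by simpa [hp, eq_comm] using mmrRoot_lastHeight hr
  refine h.exists_validChain hT hLn j (by omega) hj.le hv hC fun hj0 => ?_
  obtain ⟨d, lefts, hd, ho, hb⟩ := h.ancestry j (by omega) hj0 hj.le
  obtain ⟨p, hb, hc'⟩ := hb (by omega)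
  obtain rfl := hc.eq hT hc'
  exact ⟨d, lefts, hd, ho, ho.peaks_of_bags hT hb (by simpa using hC) hr⟩

theorem validBlock (h : DetChecked R T n L root H) (hLn : L < n) (j : ℕ) (hj : j < L) :
    ValidBlock R T (H[j]'(hj.trans (h.lt_length hLn))) := by
  have hL := h.lt_length hLn
  have hlen := h.length_eq
  obtain ⟨d, hd, hpow, hdiff⟩ := h.block j (by omega) hj.le (by omega)
  refine ⟨d, _, hd, hpow, ?_, ?_, hdiff⟩
  · have := h.linked.drop j
    rw [List.drop_eq_getElem_cons (by omega)] at this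
    exact List.IsChain.prefix this ((List.prefix_cons_inj _).2 (List.take_prefix _ _))
  · rw [List.length_take, List.length_drop]
    by_cases hw : R.window ≤ H.length - (j + 1)
    · exact .inl (by omega)
    -- Fewer than `window` predecessors were downloaded only if the download covers the whole chain,
    -- whose last entry was checked to be the genesis.
    · refine .inr ⟨by omega, ?_⟩
      rw [List.take_of_length_le (by simp; omega), List.getLast?_drop, if_neg (by omega),
        List.getLast?_eq_getElem?, List.getElem?_eq_getElem (by omega),
        h.genesis _ _ (by omega)]

/-- Equal headers carry equal commitments and hence have equal heights. Distinctness is needed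
because `maliciousWork` counts each header once. -/
theorem nodup_take (hT : T.CollisionFree) (h : DetChecked R T n L root H) (hLn : L < n) :
    (H.take L).Nodup := by
  rw [List.Nodup, List.pairwise_iff_getElem]
  intro i j hi hj hij he
  rw [List.length_take] at hi hj
  simp only [List.getElem_take] at he
  obtain ⟨p, hc, hp⟩ := h.exists_commits hLn i (by omega)
  obtain ⟨q, hc', hq⟩ := h.exists_commits hLn j (by omega)
  rw [he] at hc
  obtain rfl := hc.eq hT hc'
  omega

end DetChecked

/-! ### Work of the malicious blocks -/

theorem mem_generated {h : Header κ} {d : Digest κ} (hd : T.get (.header h) = some d) :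
    h ∈ generated T := by
  simp only [Table.get, Option.map_eq_some_iff] at hd
  obtain ⟨e, he, -⟩ := hd
  have h₁ := List.mem_of_find?_eq_some he
  have h₂ : e.1 = .header h := by simpa using List.find?_some he
  simp only [generated, List.mem_toFinset, List.mem_filterMap]
  exact ⟨e, h₁, by rw [h₂]⟩

/-- If the deterministic phase accepts an invalid chain, then the last `L` blocks are distinct valid
malicious blocks. -/
theorem DetChecked.le_maliciousWork (hT : T.CollisionFree) {n L : ℕ} {o : Outcome κ}
    (h : DetChecked R T n L o.com.root o.com.headers) (hL0 : 0 < L) (hLn : L < n)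
    (ho : ∀ x ∈ o.honest, ∃ C, ValidChain R T (x :: C)) (hv : ¬ ChainValid R n o T) :
    0 < maliciousWork R o T ∧ o.com.suffixWork L ≤ maliciousWork R o T := by
  have hL := h.lt_length hLn
  have hsub : (o.com.headers.take L).toFinset ⊆ (generated T).filter fun x =>
      x ∉ o.honest ∧ x ≠ R.genesis ∧ ValidBlock R T x := by
    intro x hx
    rw [List.mem_toFinset, List.mem_take_iff_getElem] at hx
    obtain ⟨j, hj, rfl⟩ := hx
    have hj : j < L := by omega
    have hb := h.validBlock hLn j hj
    rw [Finset.mem_filter]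
    refine ⟨mem_generated hb.choose_spec.choose_spec.1, fun hx => ?_, h.ne_genesis hLn j hj, hb⟩
    -- An honest header among them would end a valid chain, and validity would reach the tip.
    obtain ⟨C, hC⟩ := ho _ hx
    exact hv (h.exists_validChain_of_validChain hT hLn j hj hC)
  have hsum : o.com.suffixWork L ≤ maliciousWork R o T := by
    rw [Commitment.suffixWork, Commitment.difficulties, ← List.map_take,
      ← List.sum_toFinset _ (h.nodup_take hT hLn)]
    exact Finset.sum_le_sum_of_subset hsub
  refine ⟨lt_of_lt_of_le ?_ hsum, hsum⟩
  obtain ⟨d, -, hpow, -⟩ := h.block 0 (by omega) (by omega) (by omega)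
  refine hpow.1.trans_le (List.le_sum_of_mem ?_)
  rw [Commitment.difficulties, ← List.map_take]
  refine List.mem_map_of_mem ?_
  rw [List.mem_take_iff_getElem]
  exact ⟨0, by omega, rfl⟩

theorem le_sum_take_of_minSuffix_le {d : List ℕ} {x : ℝ} {L : ℕ}
    (h : minSuffix d x ≤ (L : ℕ∞)) : x ≤ ((d.take L).sum : ℕ) := by
  -- A strict upper bound on an infimum yields a member below it; this also excludes the empty set,
  -- whose infimum is `⊤`.
  have hlt : minSuffix d x < ((L + 1 : ℕ) : ℕ∞) := h.trans_lt (by exact_mod_cast Nat.lt_succ_self L)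
  simp only [minSuffix, iInf_lt_iff] at hlt
  obtain ⟨ν, ⟨-, hν⟩, hlt⟩ := hlt
  refine hν.trans ?_
  have hνL : ν ≤ L := Nat.lt_succ_iff.1 (by exact_mod_cast hlt)
  exact_mod_cast ((List.take_prefix_take_left hνL).sublist.sum_le_sum fun _ _ => Nat.zero_le _)

/-! ## Security -/

/-- The bound on the malicious work rules out accepted invalid chains as soon as acceptance implies
that of the deterministic phase. -/
theorem secure_of_detChecked {κ : ℕ → ℕ} (hκ : Negligible fun lam => (1 / 2 : ℝ) ^ κ lam)
    (R : ∀ lam, Consensus (κ lam)) (n L : ℕ → ℕ) (c w : ℕ → ℝ)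
    (hc : ∀ lam, 0 < c lam ∧ c lam < 1) (hL : ∀ lam, 0 < L lam ∧ L lam < n lam)
    (G : ∀ lam, Prog (κ lam) (Outcome (κ lam)))
    (hdet : ∀ lam o T, (G lam).Returns T o → o.accepted = true →
      DetChecked (R lam) T (n lam) (L lam) o.com.root o.com.headers)
    (hpoly : PolyBounded G) (hhonest : HonestMining R G) (hwork : IsWorkAdversary R w G) :
    Secure R n c L w G := by
  obtain ⟨p, hp⟩ := hpoly
  refine negligible_of_le hκ hwork (fun _ => ENNReal.toReal_nonneg) p fun lam => ?_
  refine le_trans ?_ (add_le_add_right (prob_collision_le (G lam) _ (hp lam)) _)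
  refine prob_le_add _ fun x hx hE => ?_
  by_cases hT : x.2.CollisionFree
  · left
    obtain ⟨hmin, hacc, hv⟩ := hE
    obtain ⟨hpos, hle⟩ := (hdet lam _ _ ((G lam).returns_of_mem_support hx) hacc).le_maliciousWork
      hT (hL lam).1 (hL lam).2 (hhonest lam x hx) hv
    have hwc := (le_sum_take_of_minSuffix_le hmin).trans (Nat.cast_le.2 hle)
    have hpos' : (0 : ℝ) < maliciousWork (R lam) x.1 x.2 := Nat.cast_pos.2 hpos
    -- With `M` the malicious work, `w ≤ M * c < M`; the strict step needs `0 < M`, whatever the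
    -- sign of `w`.
    rw [div_le_iff₀ (hc lam).1] at hwc
    nlinarith [(hc lam).2]
  · exact .inr hT

/-- Acceptance is a conjunction with the verdict of `checkDet`, so nothing about the samples or the
attacker's answers has to be kept. -/
theorem detChecked_of_interactiveGame {lam n L : ℕ} {c : ℝ} {A : InteractiveAttacker κ}
    {o : Outcome κ} (h : (interactiveGame R lam n c L A).Returns T o) (ho : o.accepted = true) :
    DetChecked R T n L o.com.root o.com.headers := by
  simp only [interactiveGame, Prog.returns_bind, Prog.returns_pure] at h
  obtain ⟨⟨com, answer⟩, -, ok, hok, us, -, ⟨os, honest⟩, -, ok', -, rfl⟩ := h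
  obtain ⟨rfl, -⟩ := (Bool.and_eq_true _ _).mp ho
  exact detChecked_of_returns hok

theorem detChecked_of_nonInteractiveGame {lam n L : ℕ} {c : ℝ} {A : NonInteractiveAttacker κ}
    {o : Outcome κ} (h : (nonInteractiveGame R lam n c L A).Returns T o) (ho : o.accepted = true) :
    DetChecked R T n L o.com.root o.com.headers := by
  simp only [nonInteractiveGame, Prog.returns_bind] at h
  obtain ⟨⟨com, os, honest⟩, -, ok, hok, h⟩ := h
  dsimp only at h hok
  split at h
  · rw [Prog.returns_pure] at h
    subst h
    cases ho
  · simp only [Prog.returns_bind, Prog.returns_pure] at h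
    obtain ⟨us, -, ok', -, rfl⟩ := h
    obtain ⟨rfl, -⟩ := (Bool.and_eq_true _ _).mp ho
    exact detChecked_of_returns hok

end FlyClient

theorem mainTheorem1 (κ : ℕ → ℕ)
    (hκ : FlyClient.Negligible fun lam => (1 / 2 : ℝ) ^ κ lam)
    (R : ∀ lam, FlyClient.Consensus (κ lam))
    (n L : ℕ → ℕ) (c w : ℕ → ℝ)
    (hc : ∀ lam, 0 < c lam ∧ c lam < 1)
    (hL : ∀ lam, 0 < L lam ∧ L lam < n lam) :
    (∀ A : ∀ lam, FlyClient.InteractiveAttacker (κ lam),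
      FlyClient.PolyBounded
        (fun lam => FlyClient.interactiveGame (R lam) lam (n lam) (c lam) (L lam) (A lam)) →
      FlyClient.HonestMining R
        (fun lam => FlyClient.interactiveGame (R lam) lam (n lam) (c lam) (L lam) (A lam)) →
      FlyClient.IsWorkAdversary R w
        (fun lam => FlyClient.interactiveGame (R lam) lam (n lam) (c lam) (L lam) (A lam)) →
      FlyClient.Secure R n c L w
        (fun lam => FlyClient.interactiveGame (R lam) lam (n lam) (c lam) (L lam) (A lam))) ∧
    (∀ A : ∀ lam, FlyClient.NonInteractiveAttacker (κ lam),
      FlyClient.PolyBounded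
        (fun lam => FlyClient.nonInteractiveGame (R lam) lam (n lam) (c lam) (L lam) (A lam)) →
      FlyClient.HonestMining R
        (fun lam => FlyClient.nonInteractiveGame (R lam) lam (n lam) (c lam) (L lam) (A lam)) →
      FlyClient.IsWorkAdversary R w
        (fun lam => FlyClient.nonInteractiveGame (R lam) lam (n lam) (c lam) (L lam) (A lam)) →
      FlyClient.Secure R n c L w
        (fun lam => FlyClient.nonInteractiveGame (R lam) lam (n lam) (c lam) (L lam) (A lam))) := by
  refine ⟨fun A hpoly hhonest hwork => ?_, fun A hpoly hhonest hwork => ?_⟩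
  · exact FlyClient.secure_of_detChecked hκ R n L c w hc hL _
      (fun lam o T h ho => FlyClient.detChecked_of_interactiveGame h ho) hpoly hhonest hwork
  · exact FlyClient.secure_of_detChecked hκ R n L c w hc hL _
      (fun lam o T h ho => FlyClient.detChecked_of_nonInteractiveGame h ho) hpoly hhonest hwork
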